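/- Let $n>m>0$ be integers and $d:=n-m$. Let $A\in\mathbb{Z}^{d\times n}$ be an integer matrix with columns $a_1,\dots,a_n$ that span $\mathbb{Z}^d$ as a lattice, and assume that $A$ is pointed, i.e. there is $h\in\mathbb{R}^d$ with $h\cdot a_i>0$ for all $i$. Let $B\in\mathbb{Z}^{n\times m}$, with rows $B_1,\dots,B_n$, be a matrix whose columns span $\ker_{\mathbb{Z}}(A)=\{w\in\mathbb{Z}^n : Aw=0\}$ as a lattice. Let $\beta\in\mathbb{C}^d$, and let $\kappa\in\mathbb{C}^n$ satisfy $A\kappa=\beta$. Let $D_X$ be the Laurent Weyl algebra $\mathbb{C}[x_1^{\pm1},\dots,x_n^{\pm1}]\langle\partial_{x_1},\dots,\partial_{x_n}\rangle$ of linear partial differential operators with Laurent polynomial coefficients on $X=(\mathbb{C}^*)^n$, and let $D_Z$ be the Laurent Weyl algebra in the variables $z_1,\dots,z_m$. Put $\theta_i:=x_i\partial_{x_i}$, $\eta_j:=z_j\partial_{z_j}$, $\eta:=(\eta_1,\dots,\eta_m)$. The torus $T=(\mathbb{C}^*)^d$ acts on $D_X$ by algebra automorphisms, $t\diamond x_i=t^{a_i}x_i$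 and $t\diamond\partial_{x_i}=t^{-a_i}\partial_{x_i}$; let $[D_X]^T$ be the subalgebra of invariants. Let $E_k:=\sum_{j=1}^n a_{kj}\theta_j\in[D_X]^T$, $1\le k\le d$, be the Euler operators of $A$. Then $[D_X]^T$ is spanned over $\mathbb{C}$ by the monomials $x^{Bv}\theta^u$ with $v\in\mathbb{Z}^m$ and $u\in\mathbb{N}^n$, and the rule $$\delta_{B,\kappa}(x^{Bv}\theta^u):=z^v\prod_{i=1}^n(B_i\cdot\eta+\kappa_i)^{u_i}\qquad(v\in\mathbb{Z}^m,\ u\in\mathbb{N}^n)$$ extends linearly to a well-defined surjective homomorphism of $\mathbb{C}$-algebras $\delta_{B,\kappa}\colon[D_X]^T\to D_Z$, whose kernel is the two-sided ideal of $[D_X]^T$ generated by $E_1-\beta_1,\dots,E_d-\beta_d$. -/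

import Mathlib

/-- The generators of the Laurent Weyl algebra in `n` variables:
the coordinates `x_i`, their inverses, and the derivations `∂_i`. -/
inductive LaurentWeylGen (n : ℕ) : Type
  | x (i : Fin n)
  | xInv (i : Fin n)
  | d (i : Fin n)

namespace LaurentWeylGen

/-- The generators as elements of the free associative `ℂ`-algebra. -/
def free {n : ℕ} (g : LaurentWeylGen n) : FreeAlgebra ℂ (LaurentWeylGen n) :=
  FreeAlgebra.ι ℂ g

end LaurentWeylGen

open LaurentWeylGen in
/-- The defining relations of the Laurent Weyl algebra: those of the Weyl algebra
(`x_i x_j = x_j x_i`, `∂_i ∂_j = ∂_j ∂_i`, `∂_i x_j = x_j ∂_i + δ_{ij}`), and the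
relations that make `xInv i` the inverse of `x_i`. -/
inductive LaurentWeylRel (n : ℕ) :
    FreeAlgebra ℂ (LaurentWeylGen n) → FreeAlgebra ℂ (LaurentWeylGen n) → Prop
  | x_comm (i j : Fin n) :
      LaurentWeylRel n ((x i).free * (x j).free) ((x j).free * (x i).free)
  | d_comm (i j : Fin n) :
      LaurentWeylRel n ((d i).free * (d j).free) ((d j).free * (d i).free)
  | d_x (i j : Fin n) :
      LaurentWeylRel n ((d i).free * (x j).free)
        ((x j).free * (d i).free + if i = j then 1 else 0)
  | x_xInv (i : Fin n) : LaurentWeylRel n ((x i).free * (xInv i).free) 1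
  | xInv_x (i : Fin n) : LaurentWeylRel n ((xInv i).free * (x i).free) 1

/-- The Laurent Weyl algebra in `n` variables, that is, the ring of linear partial differential
operators on the torus `(ℂ^*)^n`: the Weyl algebra with its `n` coordinates inverted. -/
def LaurentWeyl (n : ℕ) : Type := RingQuot (LaurentWeylRel n)

namespace LaurentWeyl

noncomputable instance (n : ℕ) : Ring (LaurentWeyl n) :=
  inferInstanceAs (Ring (RingQuot (LaurentWeylRel n)))

noncomputable instance (n : ℕ) : Algebra ℂ (LaurentWeyl n) :=
  inferInstanceAs (Algebra ℂ (RingQuot (LaurentWeylRel n)))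

/-- The projection from the free algebra. -/
noncomputable def mk (n : ℕ) : FreeAlgebra ℂ (LaurentWeylGen n) →ₐ[ℂ] LaurentWeyl n :=
  RingQuot.mkAlgHom ℂ (LaurentWeylRel n)

theorem mk_rel {n : ℕ} {a b : FreeAlgebra ℂ (LaurentWeylGen n)} (h : LaurentWeylRel n a b) :
    mk n a = mk n b :=
  RingQuot.mkAlgHom_rel ℂ h

/-- The class of a generator. -/
noncomputable def gen {n : ℕ} (g : LaurentWeylGen n) : LaurentWeyl n := mk n g.free

/-- The algebra homomorphism with prescribed values `f` on the generators. -/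
noncomputable def lift {n : ℕ} {R : Type*} [Ring R] [Algebra ℂ R] (f : LaurentWeylGen n → R)
    (hf : ∀ ⦃a b⦄, LaurentWeylRel n a b → FreeAlgebra.lift ℂ f a = FreeAlgebra.lift ℂ f b) :
    LaurentWeyl n →ₐ[ℂ] R :=
  RingQuot.liftAlgHom ℂ ⟨FreeAlgebra.lift ℂ f, hf⟩

theorem lift_gen {n : ℕ} {R : Type*} [Ring R] [Algebra ℂ R] (f : LaurentWeylGen n → R)
    (hf : ∀ ⦃a b⦄, LaurentWeylRel n a b → FreeAlgebra.lift ℂ f a = FreeAlgebra.lift ℂ f b)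
    (g : LaurentWeylGen n) : lift f hf (gen g) = f g :=
  (RingQuot.liftAlgHom_mkAlgHom_apply ℂ (FreeAlgebra.lift ℂ f) hf g.free).trans
    (FreeAlgebra.lift_ι_apply f g)

/-- The derivation `∂_i`. -/
noncomputable def d {n : ℕ} (i : Fin n) : LaurentWeyl n := gen (.d i)

theorem gen_x_mul_xInv {n : ℕ} (i : Fin n) :
    (gen (.x i) * gen (.xInv i) : LaurentWeyl n) = 1 := by
  simpa [gen] using mk_rel (LaurentWeylRel.x_xInv i)

theorem gen_xInv_mul_x {n : ℕ} (i : Fin n) :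
    (gen (.xInv i) * gen (.x i) : LaurentWeyl n) = 1 := by
  simpa [gen] using mk_rel (LaurentWeylRel.xInv_x i)

/-- The coordinate `x_i`, an invertible element. -/
noncomputable def x {n : ℕ} (i : Fin n) : (LaurentWeyl n)ˣ where
  val := gen (.x i)
  inv := gen (.xInv i)
  val_inv := gen_x_mul_xInv i
  inv_val := gen_xInv_mul_x i

/-- The operator `θ_i = x_i ∂_i`. -/
noncomputable def theta {n : ℕ} (i : Fin n) : LaurentWeyl n := (x i : LaurentWeyl n) * d i

/-- The product `f_1 f_2 ⋯ f_n`. It is used for commuting factors only. -/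
def prodFin {R : Type*} [Monoid R] {n : ℕ} (f : Fin n → R) : R := (List.ofFn f).prod

/-- The Laurent monomial `x^w = x_1^{w_1} ⋯ x_n^{w_n}` with `w ∈ ℤ^n`. -/
noncomputable def xPow {n : ℕ} (w : Fin n → ℤ) : LaurentWeyl n :=
  prodFin fun i => ((x i ^ w i : (LaurentWeyl n)ˣ) : LaurentWeyl n)

/-- The monomial `θ^u = θ_1^{u_1} ⋯ θ_n^{u_n}` with `u ∈ ℕ^n`. -/
noncomputable def thetaPow {n : ℕ} (u : Fin n → ℕ) : LaurentWeyl n :=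
  prodFin fun i => theta i ^ u i

/-! ### Rescaling the variables, and the torus action -/

/-- Images of the generators under rescaling by `c`: `x_i ↦ c_i x_i`, `∂_i ↦ c_i⁻¹ ∂_i`. -/
noncomputable def scaleGen {n : ℕ} (c : Fin n → ℂˣ) : LaurentWeylGen n → LaurentWeyl n
  | .x i => (c i : ℂ) • gen (.x i)
  | .xInv i => (((c i)⁻¹ : ℂˣ) : ℂ) • gen (.xInv i)
  | .d i => (((c i)⁻¹ : ℂˣ) : ℂ) • gen (.d i)

theorem scaleGen_rel {n : ℕ} (c : Fin n → ℂˣ) ⦃a b : FreeAlgebra ℂ (LaurentWeylGen n)⦄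
    (h : LaurentWeylRel n a b) :
    FreeAlgebra.lift ℂ (scaleGen c) a = FreeAlgebra.lift ℂ (scaleGen c) b := by
  have key := mk_rel h
  cases h with
  | x_comm i j =>
    simp only [map_mul] at key
    change gen _ * gen _ = gen _ * gen _ at key
    simp [LaurentWeylGen.free, scaleGen, key, smul_smul, mul_comm]
  | d_comm i j =>
    simp only [map_mul] at key
    change gen _ * gen _ = gen _ * gen _ at key
    simp [LaurentWeylGen.free, scaleGen, key, smul_smul, mul_comm]
  | d_x i j =>
    simp only [map_mul, map_add] at key
    change gen _ * gen _ = gen _ * gen _ + _ at key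
    by_cases hij : i = j
    · subst hij
      simp only [if_true, map_one] at key
      simp [LaurentWeylGen.free, scaleGen, key, smul_smul]
    · simp only [if_neg hij, map_zero] at key
      simp [LaurentWeylGen.free, scaleGen, key, smul_smul, mul_comm, hij]
  | x_xInv i => simp [LaurentWeylGen.free, scaleGen, gen_x_mul_xInv, smul_smul]
  | xInv_x i => simp [LaurentWeylGen.free, scaleGen, gen_xInv_mul_x, smul_smul]

/-- The algebra endomorphism `x_i ↦ c_i x_i`, `∂_i ↦ c_i⁻¹ ∂_i`. -/
noncomputable def scale {n : ℕ} (c : Fin n → ℂˣ) : LaurentWeyl n →ₐ[ℂ] LaurentWeyl n :=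
  lift (scaleGen c) (scaleGen_rel c)

theorem scale_gen {n : ℕ} (c : Fin n → ℂˣ) (g : LaurentWeylGen n) :
    scale c (gen g) = scaleGen c g :=
  lift_gen _ _ g

/-- The character `t^a = t_1^{a_1} ⋯ t_d^{a_d}` of the torus `T = (ℂ^*)^d`. -/
def character {d : ℕ} (t : Fin d → ℂˣ) (a : Fin d → ℤ) : ℂˣ := ∏ k, t k ^ a k

/-- The action of `t ∈ T = (ℂ^*)^d` given by the matrix `A` with columns `a_1, …, a_n`:
`t ⋄ x_i = t^{a_i} x_i` and `t ⋄ ∂_i = t^{-a_i} ∂_i`. -/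
noncomputable def torusAct {d n : ℕ} (A : Matrix (Fin d) (Fin n) ℤ) (t : Fin d → ℂˣ) :
    LaurentWeyl n →ₐ[ℂ] LaurentWeyl n :=
  scale fun i => character t (A.col i)

/-- The algebra of torus invariants. -/
noncomputable def invariants {d n : ℕ} (A : Matrix (Fin d) (Fin n) ℤ) :
    Subalgebra ℂ (LaurentWeyl n) where
  carrier := {P | ∀ t : Fin d → ℂˣ, torusAct A t P = P}
  mul_mem' {P Q} hP hQ t := by rw [map_mul, hP t, hQ t]
  add_mem' {P Q} hP hQ t := by rw [map_add, hP t, hQ t]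
  algebraMap_mem' r t := AlgHom.commutes _ r

/-! ### Invariant elements -/

theorem scale_theta {n : ℕ} (c : Fin n → ℂˣ) (i : Fin n) : scale c (theta i) = theta i := by
  simp [theta, x, d, scale_gen, scaleGen, smul_smul]

theorem theta_mem_invariants {d n : ℕ} (A : Matrix (Fin d) (Fin n) ℤ) (i : Fin n) :
    theta i ∈ invariants A := fun _ => scale_theta _ i

theorem prodFin_mem {d n k : ℕ} (A : Matrix (Fin d) (Fin n) ℤ) (f : Fin k → LaurentWeyl n)
    (hf : ∀ i, f i ∈ invariants A) : prodFin f ∈ invariants A :=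
  list_prod_mem fun y hy => by
    obtain ⟨i, rfl⟩ := (List.mem_ofFn' f y).1 hy
    exact hf i

theorem thetaPow_mem_invariants {d n : ℕ} (A : Matrix (Fin d) (Fin n) ℤ) (u : Fin n → ℕ) :
    thetaPow u ∈ invariants A :=
  prodFin_mem A _ fun i => pow_mem (theta_mem_invariants A i) (u i)

theorem map_scale_x {n : ℕ} (c : Fin n → ℂˣ) (i : Fin n) :
    Units.map (scale c : LaurentWeyl n →* LaurentWeyl n) (x i)
      = Units.map (algebraMap ℂ (LaurentWeyl n) : ℂ →* LaurentWeyl n) (c i) * x i := by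
  ext
  simp [x, scale_gen, scaleGen, Algebra.smul_def]

theorem scale_x_zpow {n : ℕ} (c : Fin n → ℂˣ) (i : Fin n) (k : ℤ) :
    scale c ((x i ^ k : (LaurentWeyl n)ˣ) : LaurentWeyl n)
      = (((c i) ^ k : ℂˣ) : ℂ) • ((x i ^ k : (LaurentWeyl n)ˣ) : LaurentWeyl n) := by
  have h : Commute (Units.map (algebraMap ℂ (LaurentWeyl n) : ℂ →* LaurentWeyl n) (c i)) (x i) := by
    ext
    simpa using Algebra.commutes (c i : ℂ) (x i : LaurentWeyl n)
  have h2 := congrArg (fun y : (LaurentWeyl n)ˣ => y ^ k) (map_scale_x c i)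
  simp only [h.mul_zpow] at h2
  have h3 := congrArg (Units.val) h2
  rw [← map_zpow, ← map_zpow] at h3
  rw [Algebra.smul_def]
  exact h3

theorem scale_xPow {n : ℕ} (c : Fin n → ℂˣ) (w : Fin n → ℤ) :
    scale c (xPow w) = ((∏ i, c i ^ w i : ℂˣ) : ℂ) • xPow w := by
  have aux : ∀ (k : ℕ) (f : Fin k → LaurentWeyl n) (b : Fin k → ℂˣ),
      (∀ i, scale c (f i) = (b i : ℂ) • f i) →
        scale c (prodFin f) = ((∏ i, b i : ℂˣ) : ℂ) • prodFin f := by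
    intro k
    induction k with
    | zero => intro f b _; simp [prodFin]
    | succ k ih =>
      intro f b h
      have h' := ih (fun i => f i.succ) (fun i => b i.succ) fun i => h i.succ
      simp only [prodFin] at h'
      simp [prodFin, List.ofFn_succ, h 0, h', Fin.prod_univ_succ, smul_smul, mul_comm]
  exact aux n _ _ fun i => scale_x_zpow c i (w i)

theorem xPow_mem_invariants {d n : ℕ} (A : Matrix (Fin d) (Fin n) ℤ) (w : Fin n → ℤ)
    (hw : A.mulVec w = 0) : xPow w ∈ invariants A := by
  intro t
  have h : ∏ i, character t (A.col i) ^ w i = 1 := by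
    simp only [character, ← Finset.prod_zpow, ← zpow_mul]
    rw [Finset.prod_comm]
    refine Finset.prod_eq_one fun k _ => ?_
    have hk := congrFun hw k
    simp only [Matrix.mulVec, dotProduct, Pi.zero_apply] at hk
    have hs : ∀ s : Finset (Fin n), ∏ i ∈ s, t k ^ (A k i * w i) = t k ^ ∑ i ∈ s, A k i * w i := by
      intro s
      induction s using Finset.cons_induction with
      | empty => simp
      | cons a s ha ih => rw [Finset.prod_cons, Finset.sum_cons, zpow_add, ih]
    simp only [Matrix.col_apply]
    rw [hs, hk, zpow_zero]
  rw [torusAct, scale_xPow, h]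
  simp

/-- The invariant operator `x^w θ^u`, where `w` lies in the integer kernel of `A`. -/
noncomputable def invMonomial {d n : ℕ} (A : Matrix (Fin d) (Fin n) ℤ) (w : Fin n → ℤ)
    (hw : A.mulVec w = 0) (u : Fin n → ℕ) : invariants A :=
  ⟨xPow w * thetaPow u, mul_mem (xPow_mem_invariants A w hw) (thetaPow_mem_invariants A u)⟩

theorem mulVec_mulVec_eq_zero {d n m : ℕ} {A : Matrix (Fin d) (Fin n) ℤ}
    {B : Matrix (Fin n) (Fin m) ℤ}
    (hB : Submodule.span ℤ (Set.range B.col) = LinearMap.ker A.mulVecLin) (v : Fin m → ℤ) :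
    A.mulVec (B.mulVec v) = 0 := by
  have h : B.mulVec v ∈ Submodule.span ℤ (Set.range B.col) := by
    rw [← Matrix.range_mulVecLin]
    exact ⟨v, rfl⟩
  rw [hB] at h
  exact h

/-- The Euler operators `E_k = ∑_j a_{kj} θ_j` of `A`, as invariant operators. -/
noncomputable def euler {d n : ℕ} (A : Matrix (Fin d) (Fin n) ℤ) (k : Fin d) : invariants A :=
  ∑ j, A k j • (⟨theta j, theta_mem_invariants A j⟩ : invariants A)

/-- The operator `z^v ∏_i (B_i · η + κ_i)^{u_i}`, where `z_1, …, z_m` are the coordinates,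
`η_j = z_j ∂_{z_j}`, and `B_i` is the `i`-th row of `B`. -/
noncomputable def hornMonomial {n m : ℕ} (B : Matrix (Fin n) (Fin m) ℤ) (κ : Fin n → ℂ)
    (v : Fin m → ℤ) (u : Fin n → ℕ) : LaurentWeyl m :=
  xPow v * prodFin fun i =>
    ((∑ j, B i j • (theta j : LaurentWeyl m)) + algebraMap ℂ (LaurentWeyl m) (κ i)) ^ u i

end LaurentWeyl

/-!
The Laurent Weyl algebra acts faithfully on functions `f` on `ℂ^n`, viewed as coefficients of formal
series `∑_s f(s) x^s`: the monomial `x^w` shifts by `w`, and `θ_i` multiplies by the coordinate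
`s_i`. An invariant operator only shifts along `ker A = B ℤ^m`, hence it acts on functions
restricted along `s ↦ B s + κ`, and there it acts as an operator in `m` variables. As the action in
`m` variables is faithful and restriction is surjective, this defines an algebra homomorphism `δ`.

On normal forms `∑_v x^{Bv} p_v(θ)`, `δ` substitutes `B η + κ` for `θ` in each coefficient. This is
surjective because `B` has a left inverse over `ℂ`, and an operator is killed exactly when every
`p_v` vanishes on the affine subspace `κ + im B`. The ideal of this subspace is generated by the
affine forms `A s - β`, whose values at `s = θ` are the operators `E_k - β_k`.
-/

/-! ### Affine substitutions in polynomials -/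

section AffineSubstitution

open Matrix MvPolynomial

variable {R ι σ τ : Type*} [CommRing R] [Fintype τ]

/-- The affine form `a · X + b`. -/
noncomputable def affineForm (a : τ → R) (b : R) : MvPolynomial τ R :=
  ∑ j, a j • X j + C b

theorem affineForm_zero : affineForm (0 : τ → R) 0 = 0 := by
  simp [affineForm]

theorem affineForm_one_row [DecidableEq τ] (i : τ) :
    affineForm ((1 : Matrix τ τ R) i) 0 = X i := by
  simp [affineForm, one_apply]

theorem affineForm_sub (a a' : τ → R) (b b' : R) :
    affineForm a b - affineForm a' b' = affineForm (a - a') (b - b') := by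
  simp only [affineForm, Pi.sub_apply, sub_smul, Finset.sum_sub_distrib, map_sub]
  abel

theorem sum_smul_affineForm [Fintype ι] (c : ι → R) (A : Matrix ι τ R) (b : ι → R) :
    ∑ k, c k • affineForm (A k) (b k) = affineForm (c ᵥ* A) (c ⬝ᵥ b) := by
  have hX : ∑ k, c k • ∑ j, A k j • X j = ∑ j, (c ᵥ* A) j • (X j : MvPolynomial τ R) := by
    simp only [Finset.smul_sum, smul_smul, vecMul, dotProduct, Finset.sum_smul]
    exact Finset.sum_comm
  have hC : ∑ k, c k • C (b k) = C (σ := τ) (c ⬝ᵥ b) := by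
    simp only [dotProduct, map_sum, map_mul, smul_eq_C_mul]
  simp only [affineForm, smul_add, Finset.sum_add_distrib, hX, hC]

/-- The substitution `p(X) ↦ p(M X + b)` of affine forms into polynomials. -/
noncomputable def affineSubst (M : Matrix σ τ R) (b : σ → R) :
    MvPolynomial σ R →ₐ[R] MvPolynomial τ R :=
  aeval fun i => affineForm (M i) (b i)

theorem affineSubst_X (M : Matrix σ τ R) (b : σ → R) (i : σ) :
    affineSubst M b (X i) = affineForm (M i) (b i) :=
  aeval_X _ _

theorem eval_affineSubst (M : Matrix σ τ R) (b : σ → R) (s : τ → R) (p : MvPolynomial σ R) :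
    eval s (affineSubst M b p) = eval (M *ᵥ s + b) p := by
  have h : (aeval s).comp (affineSubst M b) = aeval (M *ᵥ s + b) :=
    algHom_ext fun i => by simp [affineSubst_X, affineForm, mulVec, dotProduct]
  exact DFunLike.congr_fun h p

variable [Fintype σ]

theorem affineSubst_affineForm (M : Matrix σ τ R) (b a : σ → R) (c : R) :
    affineSubst M b (affineForm a c) = affineForm (a ᵥ* M) (a ⬝ᵥ b + c) := by
  have hX : affineSubst M b (affineForm a c) = ∑ i, a i • affineForm (M i) (b i) + C c := by
    rw [affineForm, map_add, map_sum, ← algebraMap_eq, AlgHom.commutes]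
    simp only [map_smul, affineSubst_X]
    rfl
  rw [hX, sum_smul_affineForm, affineForm, affineForm, map_add, add_assoc]

theorem affineSubst_affineSubst_of_mul_eq_one [DecidableEq τ] {M : Matrix σ τ R}
    {D : Matrix τ σ R} (hDM : D * M = 1) (b : σ → R) (q : MvPolynomial τ R) :
    affineSubst M b (affineSubst D (-(D *ᵥ b)) q) = q := by
  have h : (affineSubst M b).comp (affineSubst D (-(D *ᵥ b))) = AlgHom.id R _ := by
    refine algHom_ext fun j => ?_
    have hj : D j ᵥ* M = (1 : Matrix τ τ R) j := by rw [← hDM]; rfl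
    rw [AlgHom.comp_apply, affineSubst_X, affineSubst_affineForm, hj, Pi.neg_apply, mulVec,
      add_neg_cancel, affineForm_one_row, AlgHom.id_apply]
  exact DFunLike.congr_fun h q

theorem algHom_sub_algHom_mem {S : Type*} [CommRing S] [Algebra R S]
    {φ ψ : MvPolynomial ι R →ₐ[R] S} {I : Ideal S} (h : ∀ i, φ (X i) - ψ (X i) ∈ I)
    (p : MvPolynomial ι R) : φ p - ψ p ∈ I := by
  have hI : (Ideal.Quotient.mkₐ R I).comp φ = (Ideal.Quotient.mkₐ R I).comp ψ :=
    algHom_ext fun i => Ideal.Quotient.eq.2 (h i)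
  exact Ideal.Quotient.eq.1 (DFunLike.congr_fun hI p)

theorem ker_affineSubst [Fintype ι] [DecidableEq σ] {A : Matrix ι σ R} {M : Matrix σ τ R}
    {C : Matrix σ ι R} {D : Matrix τ σ R} (hAM : A * M = 0) (h : C * A + M * D = 1) (b : σ → R) :
    RingHom.ker (affineSubst M b)
      = Ideal.span (Set.range fun k => affineForm (A k) (-(A *ᵥ b) k)) := by
  set I := Ideal.span (Set.range fun k => affineForm (A k) (-(A *ᵥ b) k))
  refine le_antisymm (fun p hp => ?_) (Ideal.span_le.2 ?_)
  · -- `ρ` substitutes `M D (X - b) + b` for `X`, and `X - ρ X = C (A X - A b)`.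
    let ρ := (affineSubst D (-(D *ᵥ b))).comp (affineSubst M b)
    have hX (i : σ) : X i - ρ (X i) = ∑ k, C i k • affineForm (A k) (-(A *ᵥ b) k) := by
      have hrow : (1 : Matrix σ σ R) i - M i ᵥ* D = C i ᵥ* A := by
        rw [← h]
        exact add_sub_cancel_right _ _
      have hconst : 0 - (M i ⬝ᵥ -(D *ᵥ b) + b i) = C i ⬝ᵥ -(A *ᵥ b) := by
        have hb : (C *ᵥ (A *ᵥ b) + M *ᵥ (D *ᵥ b)) i = b i := by
          rw [mulVec_mulVec, mulVec_mulVec, ← add_mulVec, h, one_mulVec]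
        rw [← hb, Pi.add_apply, mulVec, mulVec, dotProduct_neg, dotProduct_neg]
        ring
      calc X i - ρ (X i)
          = affineForm ((1 : Matrix σ σ R) i) 0
              - affineForm (M i ᵥ* D) (M i ⬝ᵥ -(D *ᵥ b) + b i) := by
            rw [AlgHom.comp_apply, affineSubst_X, affineSubst_affineForm, affineForm_one_row]
        _ = affineForm (C i ᵥ* A) (C i ⬝ᵥ -(A *ᵥ b)) := by rw [affineForm_sub, hrow, hconst]
        _ = ∑ k, C i k • affineForm (A k) (-(A *ᵥ b) k) := (sum_smul_affineForm _ _ _).symm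
    have hsub : p - ρ p ∈ I := by
      refine algHom_sub_algHom_mem (φ := AlgHom.id R _) (fun i => ?_) p
      rw [AlgHom.id_apply, hX]
      exact sum_mem fun k _ => Submodule.smul_of_tower_mem _ _ (Ideal.subset_span ⟨k, rfl⟩)
    rwa [AlgHom.comp_apply, show affineSubst M b p = 0 from hp, map_zero, sub_zero] at hsub
  · rintro _ ⟨k, rfl⟩
    have hk : A k ᵥ* M = 0 := congrFun hAM k
    change affineSubst M b _ = 0
    rw [affineSubst_affineForm, hk, mulVec, add_neg_cancel, affineForm_zero]

end AffineSubstitution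

/-! ### Integer matrices and their kernels -/

section IntegerMatrices

open Matrix

variable {ι σ τ : Type*} [Fintype σ]

theorem linearIndependent_col_of_span_col_eq_ker {R : Type*} [CommRing R] [IsDomain R] [Fintype ι]
    [Fintype τ] {A : Matrix ι σ R} {B : Matrix σ τ R}
    (hcard : Fintype.card σ = Fintype.card ι + Fintype.card τ)
    (hA : Submodule.span R (Set.range A.col) = ⊤)
    (hB : Submodule.span R (Set.range B.col) = LinearMap.ker A.mulVecLin) :
    LinearIndependent R B.col := by
  have hrank := Submodule.finrank_quotient_add_finrank (LinearMap.ker A.mulVecLin)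
  rw [A.mulVecLin.quotKerEquivRange.finrank_eq, range_mulVecLin, hA, finrank_top,
    Module.finrank_fintype_fun_eq_card, Module.finrank_fintype_fun_eq_card, ← hB, hcard] at hrank
  exact linearIndependent_iff_card_eq_finrank_span.2 (Nat.add_left_cancel hrank).symm

theorem map_intCast_mul_eq_zero {R : Type*} [CommRing R] {A : Matrix ι σ ℤ} {B : Matrix σ τ ℤ}
    (hB : Submodule.span ℤ (Set.range B.col) = LinearMap.ker A.mulVecLin) :
    A.map (Int.cast : ℤ → R) * B.map (Int.cast : ℤ → R) = 0 := by
  have hAB : A * B = 0 := by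
    ext i j
    exact congrFun (hB.le (Submodule.subset_span ⟨j, rfl⟩) : A *ᵥ B.col j = 0) i
  calc A.map (Int.cast : ℤ → R) * B.map (Int.cast : ℤ → R)
      = (A * B).map Int.cast := (Matrix.map_mul (f := Int.castRingHom R)).symm
    _ = 0 := by rw [hAB, Matrix.map_zero _ (Int.cast_zero (R := R))]

theorem intCast_comp_mulVec {R : Type*} [CommRing R] (A : Matrix ι σ ℤ) (w : σ → ℤ) :
    (Int.cast : ℤ → R) ∘ (A *ᵥ w) = A.map Int.cast *ᵥ (Int.cast ∘ w) :=
  funext fun i => RingHom.map_mulVec (Int.castRingHom R) A w i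

variable {K : Type*} [Field K] [CharZero K]

theorem exists_mul_map_intCast_eq [Fintype ι] {A : Matrix ι σ ℤ} {M : Matrix τ σ K}
    (h : ∀ w : σ → ℤ, A *ᵥ w = 0 → M *ᵥ (Int.cast ∘ w) = 0) :
    ∃ C : Matrix τ ι K, C * A.map (Int.cast : ℤ → K) = M := by
  classical
  have hrow (i : τ) : ∃ c : ι → K, c ᵥ* A.map Int.cast = M i := by
    let g : (σ → ℤ) →ₗ[ℤ] K := Fintype.linearCombination ℤ (M i)
    have hg : LinearMap.ker A.mulVecLin ≤ LinearMap.ker g := fun w hw => by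
      simpa [g, Fintype.linearCombination_apply, mulVec, dotProduct, mul_comm]
        using congrFun (h w hw) i
    have hinj : Function.Injective ((LinearMap.ker A.mulVecLin).liftQ A.mulVecLin le_rfl) :=
      LinearMap.ker_eq_bot.1 (Submodule.ker_liftQ_eq_bot' _ _ rfl)
    -- The divisible group `K` is an injective `ℤ`-module: `g` extends along `ℤ^σ / ker A ↪ ℤ^ι`.
    obtain ⟨f, hf⟩ := (Module.Baer.of_divisible K).extension_property _ hinj
      ((LinearMap.ker A.mulVecLin).liftQ g hg)
    have hfA (w : σ → ℤ) : f (A *ᵥ w) = g w :=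
      LinearMap.congr_fun hf (Submodule.Quotient.mk w)
    refine ⟨fun k => f (Pi.single k 1), funext fun j => ?_⟩
    have hj := hfA (Pi.single j 1)
    rw [mulVec_single_one, pi_eq_sum_univ' (A.col j), map_sum] at hj
    simp only [map_smul] at hj
    simpa [g, vecMul, dotProduct, mul_comm, Fintype.linearCombination_apply_single] using hj
  choose C hC using hrow
  exact ⟨of C, funext hC⟩

theorem exists_splitting [Fintype ι] [Fintype τ] [DecidableEq σ] [DecidableEq τ]
    {A : Matrix ι σ ℤ} {B : Matrix σ τ ℤ} (hBind : LinearIndependent ℤ B.col)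
    (hB : Submodule.span ℤ (Set.range B.col) = LinearMap.ker A.mulVecLin) :
    ∃ (C : Matrix σ ι K) (D : Matrix τ σ K),
      C * A.map (Int.cast : ℤ → K) + B.map (Int.cast : ℤ → K) * D = 1 ∧
        D * B.map (Int.cast : ℤ → K) = 1 := by
  obtain ⟨D, hD⟩ : ∃ D : Matrix τ σ K, D * B.map (Int.cast : ℤ → K) = 1 := by
    refine exists_mul_map_intCast_eq (A := B) fun v hv => ?_
    have hv0 : v = 0 := mulVec_injective_iff.2 hBind (hv.trans (mulVec_zero B).symm)
    rw [hv0, one_mulVec]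
    exact funext fun _ => Int.cast_zero
  obtain ⟨C, hC⟩ : ∃ C : Matrix σ ι K,
      C * A.map (Int.cast : ℤ → K) = 1 - B.map (Int.cast : ℤ → K) * D := by
    refine exists_mul_map_intCast_eq (A := A) fun w hw => ?_
    obtain ⟨v, rfl⟩ : w ∈ LinearMap.range B.mulVecLin := by
      rw [range_mulVecLin, hB]
      exact hw
    rw [mulVecLin_apply, intCast_comp_mulVec, mulVec_mulVec, Matrix.sub_mul, Matrix.mul_assoc, hD,
      Matrix.mul_one, Matrix.one_mul, sub_self, zero_mulVec]
  exact ⟨C, D, by rw [hC, sub_add_cancel], hD⟩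

end IntegerMatrices

/-! ### Intertwined representations -/

section Intertwining

variable {K R S V W : Type*} [CommSemiring K] [Semiring R] [Semiring S] [Algebra K R] [Algebra K S]
  [AddCommMonoid V] [AddCommMonoid W] [Module K V] [Module K W]
  {ρ : R →ₐ[K] Module.End K V} {σ : S →ₐ[K] Module.End K W} {T : V →ₗ[K] W}

theorem eq_of_intertwines (hσ : Function.Injective σ) (hT : Function.Surjective T) {r : R}
    {s s' : S} (h : T ∘ₗ ρ r = σ s ∘ₗ T) (h' : T ∘ₗ ρ r = σ s' ∘ₗ T) : s = s' :=
  hσ ((LinearMap.cancel_right hT).1 (h.symm.trans h'))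

theorem exists_algHom_intertwines (hσ : Function.Injective σ) (hT : Function.Surjective T)
    (h : ∀ r, ∃ s, T ∘ₗ ρ r = σ s ∘ₗ T) : ∃ δ : R →ₐ[K] S, ∀ r, T ∘ₗ ρ r = σ (δ r) ∘ₗ T := by
  choose δ hδ using h
  have hscalar (c : K) : δ (algebraMap K R c) = algebraMap K S c := by
    refine eq_of_intertwines hσ hT (hδ _) ?_
    rw [AlgHom.commutes, AlgHom.commutes]
    exact LinearMap.ext fun v => map_smul T c v
  have hmul (r r' : R) : δ (r * r') = δ r * δ r' := by
    refine eq_of_intertwines hσ hT (hδ _) ?_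
    rw [map_mul, map_mul, Module.End.mul_eq_comp, Module.End.mul_eq_comp, ← LinearMap.comp_assoc,
      hδ, LinearMap.comp_assoc, hδ, LinearMap.comp_assoc]
  have hadd (r r' : R) : δ (r + r') = δ r + δ r' := by
    refine eq_of_intertwines hσ hT (hδ _) ?_
    rw [map_add, map_add, LinearMap.comp_add, LinearMap.add_comp, hδ, hδ]
  exact ⟨{  toFun := δ
            map_one' := by simpa using hscalar 1
            map_mul' := hmul
            map_zero' := by simpa using hscalar 0
            map_add' := hadd
            commutes' := hscalar }, hδ⟩

end Intertwining

namespace LaurentWeyl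

open MvPolynomial

/-! ### Products of commuting factors -/

section ProdFin

variable {R : Type*} [Monoid R] {n : ℕ}

theorem prodFin_succ (f : Fin (n + 1) → R) : prodFin f = f 0 * prodFin fun i => f i.succ := by
  simp [prodFin, List.ofFn_succ]

theorem prodFin_one : prodFin (fun _ : Fin n => (1 : R)) = 1 := by
  simp [prodFin]

theorem commute_prodFin {a : R} {f : Fin n → R} (h : ∀ i, Commute a (f i)) :
    Commute a (prodFin f) :=
  Commute.list_prod_right _ _ fun _ hy => by
    obtain ⟨i, rfl⟩ := (List.mem_ofFn' f _).1 hy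
    exact h i

theorem prodFin_mul {f g : Fin n → R} (h : ∀ i j, Commute (f i) (g j)) :
    prodFin (fun i => f i * g i) = prodFin f * prodFin g := by
  induction n with
  | zero => simp [prodFin]
  | succ n ih =>
    have hc : Commute (g 0) (prodFin fun i => f i.succ) :=
      commute_prodFin fun i => (h i.succ 0).symm
    rw [prodFin_succ, prodFin_succ f, prodFin_succ g, ih fun i j => h i.succ j.succ,
      hc.mul_mul_mul_comm]

theorem prodFin_eq_single {f : Fin n → R} (i : Fin n) (h : ∀ j, j ≠ i → f j = 1) :
    prodFin f = f i := by
  induction n with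
  | zero => exact i.elim0
  | succ n ih =>
    rw [prodFin_succ]
    cases i using Fin.cases with
    | zero => rw [funext fun j : Fin n => h _ (Fin.succ_ne_zero j), prodFin_one, mul_one]
    | succ i =>
      rw [h 0 (Fin.succ_ne_zero i).symm, one_mul]
      exact ih i fun j hj => h _ fun e => hj (Fin.succ_injective _ e)

theorem map_prodFin {S F : Type*} [Monoid S] [FunLike F R S] [MonoidHomClass F R S]
    (φ : F) (f : Fin n → R) : φ (prodFin f) = prodFin fun i => φ (f i) := by
  rw [prodFin, map_list_prod, List.map_ofFn]
  rfl

end ProdFin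

/-! ### Commutation relations -/

section Relations

variable {n : ℕ}

theorem commute_x (i j : Fin n) : Commute (x i) (x j) := by
  ext
  simpa [gen, x] using mk_rel (LaurentWeylRel.x_comm i j)

theorem xPow_zero : xPow (0 : Fin n → ℤ) = 1 := by
  simp [xPow, prodFin_one]

theorem xPow_add (w w' : Fin n → ℤ) : xPow (w + w') = xPow w * xPow w' := by
  rw [xPow, xPow, xPow, ← prodFin_mul fun i j => ((commute_x i j).zpow_zpow _ _).units_val]
  simp only [Pi.add_apply, zpow_add, Units.val_mul]

theorem xPow_single (i : Fin n) (k : ℤ) : xPow (Pi.single i k) = ↑(x i ^ k) := by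
  rw [xPow, prodFin_eq_single i fun j hj => by rw [Pi.single_eq_of_ne hj]; simp,
    Pi.single_eq_same]

theorem gen_x_eq_xPow (i : Fin n) : gen (.x i) = xPow (Pi.single i 1) := by
  rw [xPow_single, zpow_one]
  rfl

theorem gen_xInv_eq_xPow (i : Fin n) : gen (.xInv i) = xPow (Pi.single i (-1)) := by
  rw [xPow_single, zpow_neg_one]
  rfl

theorem gen_d_eq_xPow_mul_theta (i : Fin n) :
    gen (.d i) = xPow (Pi.single i (-1)) * theta i := by
  rw [xPow_single, zpow_neg_one, theta, Units.inv_mul_cancel_left]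
  rfl

theorem d_mul_x (i j : Fin n) :
    (d i * x j : LaurentWeyl n) = x j * d i + if i = j then 1 else 0 := by
  have h := mk_rel (LaurentWeylRel.d_x i j)
  split_ifs at h ⊢ <;> simpa [gen, x, d] using h

theorem commute_d (i j : Fin n) : Commute (d i) (d j) := by
  simpa [gen, d, Commute, SemiconjBy] using mk_rel (LaurentWeylRel.d_comm i j)

theorem theta_mul_x (i j : Fin n) :
    (theta i * x j : LaurentWeyl n) = x j * (theta i + if i = j then 1 else 0) := by
  rw [theta, mul_assoc, d_mul_x, mul_add, ← mul_assoc, (commute_x i j).units_val.eq, mul_assoc,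
    mul_add]
  split_ifs with h
  · rw [h]
  · simp only [mul_zero]

theorem commute_theta (i j : Fin n) : Commute (theta i) (theta j) := by
  rcases eq_or_ne i j with rfl | h
  · exact Commute.refl _
  have hx : Commute (theta i) (x j : LaurentWeyl n) := by
    simpa [h, Commute, SemiconjBy] using theta_mul_x i j
  have hd : Commute (x i : LaurentWeyl n) (d j) := by
    simpa [h.symm, Commute, SemiconjBy] using (d_mul_x j i).symm
  exact hx.mul_right (hd.mul_left (commute_d i j))

theorem theta_mul_x_inv (i j : Fin n) :
    (theta i * ↑(x j)⁻¹ : LaurentWeyl n) = ↑(x j)⁻¹ * (theta i - if i = j then 1 else 0) := by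
  rw [Units.eq_inv_mul_iff_mul_eq, ← mul_assoc, Units.mul_inv_eq_iff_eq_mul, sub_mul, theta_mul_x,
    mul_add]
  split_ifs <;> simp

theorem intVec_induction {ι : Type*} [Finite ι] [DecidableEq ι] {motive : (ι → ℤ) → Prop}
    (zero : motive 0) (add : ∀ v w, motive v → motive w → motive (v + w))
    (single : ∀ i, motive (Pi.single i 1)) (single_neg : ∀ i, motive (Pi.single i (-1)))
    (w : ι → ℤ) : motive w := by
  refine Pi.single_induction motive w zero add fun i k => ?_
  induction k using Int.induction_on with
  | zero => simpa using zero
  | succ k ih => rw [Pi.single_add]; exact add _ _ ih (single i)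
  | pred k ih => rw [sub_eq_add_neg, Pi.single_add]; exact add _ _ ih (single_neg i)

theorem theta_mul_xPow (i : Fin n) (w : Fin n → ℤ) :
    theta i * xPow w = xPow w * (theta i + algebraMap ℂ (LaurentWeyl n) (w i)) := by
  induction w using intVec_induction with
  | zero => simp [xPow_zero]
  | add v w hv hw =>
    rw [xPow_add, ← mul_assoc, hv, mul_assoc, add_mul, hw, Algebra.commutes]
    simp only [mul_add, mul_assoc, Pi.add_apply, Int.cast_add, map_add]
    abel
  | single j =>
    rw [xPow_single, zpow_one, theta_mul_x]
    rcases eq_or_ne i j with rfl | h <;> simp [*]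
  | single_neg j =>
    rw [xPow_single, zpow_neg_one, theta_mul_x_inv]
    rcases eq_or_ne i j with rfl | h <;> simp [*, sub_eq_add_neg]

end Relations

/-! ### Normal forms -/

section NormalForm

variable {n : ℕ}

variable (n) in
/-- The algebra homomorphism `p ↦ p(θ_1, …, θ_n)`. It is built from its values `θ^u` on monomials,
since `MvPolynomial.aeval` requires a commutative target. -/
noncomputable def thetaPoly : MvPolynomial (Fin n) ℂ →ₐ[ℂ] LaurentWeyl n :=
  AddMonoidAlgebra.lift ℂ (LaurentWeyl n) (Fin n →₀ ℕ)
    { toFun := fun u => thetaPow (u.toAdd : Fin n →₀ ℕ)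
      map_one' := by simp [thetaPow, prodFin_one]
      map_mul' := fun u v => by
        rw [thetaPow, thetaPow, thetaPow, ← prodFin_mul fun i j => (commute_theta i j).pow_pow _ _]
        simp [pow_add] }

theorem thetaPoly_X (i : Fin n) : thetaPoly n (X i) = theta i := by
  have h : thetaPoly n (X i) = (1 : ℂ) • thetaPow (Finsupp.single i 1) :=
    AddMonoidAlgebra.lift_single _ _ _
  rw [h, one_smul, thetaPow, prodFin_eq_single i fun j hj => by simp [hj.symm],
    Finsupp.single_eq_same, pow_one]

theorem thetaPoly_prod_pow {k : ℕ} (q : Fin k → MvPolynomial (Fin n) ℂ) (u : Fin k → ℕ) :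
    thetaPoly n (∏ i, q i ^ u i) = prodFin fun i => thetaPoly n (q i) ^ u i := by
  rw [← List.prod_ofFn]
  change thetaPoly n (prodFin fun i => q i ^ u i) = _
  simp only [map_prodFin, map_pow]

variable (n) in
/-- The operator `∑_w x^w p_w(θ)` with coefficients `p_w`. -/
noncomputable def normalForm : ((Fin n → ℤ) →₀ MvPolynomial (Fin n) ℂ) →ₗ[ℂ] LaurentWeyl n :=
  Finsupp.lsum ℂ fun w => LinearMap.mulLeft ℂ (xPow w) ∘ₗ (thetaPoly n).toLinearMap

theorem normalForm_apply (F : (Fin n → ℤ) →₀ MvPolynomial (Fin n) ℂ) :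
    normalForm n F = F.sum fun w p => xPow w * thetaPoly n p := rfl

theorem normalForm_single (w : Fin n → ℤ) (p : MvPolynomial (Fin n) ℂ) :
    normalForm n (Finsupp.single w p) = xPow w * thetaPoly n p := by
  simp [normalForm]

theorem xPow_mul_mem_range_normalForm (w : Fin n → ℤ) {P : LaurentWeyl n}
    (hP : P ∈ LinearMap.range (normalForm n)) : xPow w * P ∈ LinearMap.range (normalForm n) := by
  obtain ⟨F, rfl⟩ := hP
  rw [normalForm_apply, Finsupp.mul_sum]
  refine sum_mem fun v _ => ⟨Finsupp.single (w + v) (F v), ?_⟩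
  rw [normalForm_single, xPow_add, mul_assoc]

theorem theta_mul_mem_range_normalForm (i : Fin n) {P : LaurentWeyl n}
    (hP : P ∈ LinearMap.range (normalForm n)) : theta i * P ∈ LinearMap.range (normalForm n) := by
  obtain ⟨F, rfl⟩ := hP
  rw [normalForm_apply, Finsupp.mul_sum]
  refine sum_mem fun v _ => ⟨Finsupp.single v ((X i + C (v i : ℂ)) * F v), ?_⟩
  rw [normalForm_single, map_mul, map_add, thetaPoly_X, ← algebraMap_eq, AlgHom.commutes,
    ← mul_assoc, ← theta_mul_xPow, mul_assoc]

theorem gen_mul_mem_range_normalForm (g : LaurentWeylGen n) {P : LaurentWeyl n}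
    (hP : P ∈ LinearMap.range (normalForm n)) : gen g * P ∈ LinearMap.range (normalForm n) := by
  cases g with
  | x i =>
    rw [gen_x_eq_xPow]
    exact xPow_mul_mem_range_normalForm _ hP
  | xInv i =>
    rw [gen_xInv_eq_xPow]
    exact xPow_mul_mem_range_normalForm _ hP
  | d i =>
    rw [gen_d_eq_xPow_mul_theta, mul_assoc]
    exact xPow_mul_mem_range_normalForm _ (theta_mul_mem_range_normalForm i hP)

theorem induction_on {motive : LaurentWeyl n → Prop} (P : LaurentWeyl n)
    (algebraMap : ∀ c, motive (algebraMap ℂ _ c)) (gen : ∀ g, motive (gen g))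
    (mul : ∀ P Q, motive P → motive Q → motive (P * Q))
    (add : ∀ P Q, motive P → motive Q → motive (P + Q)) : motive P := by
  obtain ⟨a, rfl⟩ : ∃ a, mk n a = P := RingQuot.mkAlgHom_surjective ℂ (LaurentWeylRel n) P
  induction a using FreeAlgebra.induction with
  | grade0 c => rw [AlgHom.commutes]; exact algebraMap c
  | grade1 g => exact gen g
  | mul a b ha hb => rw [map_mul]; exact mul _ _ ha hb
  | add a b ha hb => rw [map_add]; exact add _ _ ha hb

theorem mul_mem_range_normalForm (P : LaurentWeyl n) :
    ∀ Q ∈ LinearMap.range (normalForm n), P * Q ∈ LinearMap.range (normalForm n) := by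
  induction P using induction_on with
  | algebraMap c =>
    intro Q hQ
    rw [← Algebra.smul_def]
    exact Submodule.smul_mem _ c hQ
  | gen g => exact fun Q hQ => gen_mul_mem_range_normalForm g hQ
  | mul P P' hP hP' =>
    intro Q hQ
    rw [mul_assoc]
    exact hP _ (hP' _ hQ)
  | add P P' hP hP' =>
    intro Q hQ
    rw [add_mul]
    exact add_mem (hP _ hQ) (hP' _ hQ)

theorem normalForm_surjective : Function.Surjective (normalForm n) := fun P => by
  have h1 : (1 : LaurentWeyl n) ∈ LinearMap.range (normalForm n) :=
    ⟨Finsupp.single 0 1, by rw [normalForm_single, xPow_zero, map_one, one_mul]⟩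
  rw [← LinearMap.mem_range, ← mul_one P]
  exact mul_mem_range_normalForm P 1 h1

end NormalForm

/-! ### The Mellin representation -/

section Mellin

variable {n : ℕ}

/-- The images of the generators under `mellin`. -/
noncomputable def mellinGen : LaurentWeylGen n → Module.End ℂ ((Fin n → ℂ) → ℂ)
  | .x i => LinearMap.funLeft ℂ ℂ (· - Pi.single i 1)
  | .xInv i => LinearMap.funLeft ℂ ℂ (· + Pi.single i 1)
  | .d i => LinearMap.funLeft ℂ ℂ (· + Pi.single i 1) ∘ₗ LinearMap.mulLeft ℂ fun s => s i

theorem mellinGen_x_apply (i : Fin n) (f : (Fin n → ℂ) → ℂ) (s : Fin n → ℂ) :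
    mellinGen (.x i) f s = f (s - Pi.single i 1) := rfl

theorem mellinGen_xInv_apply (i : Fin n) (f : (Fin n → ℂ) → ℂ) (s : Fin n → ℂ) :
    mellinGen (.xInv i) f s = f (s + Pi.single i 1) := rfl

theorem mellinGen_d_apply (i : Fin n) (f : (Fin n → ℂ) → ℂ) (s : Fin n → ℂ) :
    mellinGen (.d i) f s = (s i + 1) * f (s + Pi.single i 1) := by
  simp [mellinGen, LinearMap.funLeft]

theorem mellinGen_rel ⦃a b : FreeAlgebra ℂ (LaurentWeylGen n)⦄ (h : LaurentWeylRel n a b) :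
    FreeAlgebra.lift ℂ mellinGen a = FreeAlgebra.lift ℂ mellinGen b := by
  refine LinearMap.ext fun f => funext fun s => ?_
  cases h <;> simp only [LaurentWeylGen.free, map_mul, map_add, map_one, FreeAlgebra.lift_ι_apply,
    Module.End.mul_apply, Module.End.one_apply, LinearMap.add_apply, Pi.add_apply,
    mellinGen_x_apply, mellinGen_xInv_apply, mellinGen_d_apply]
  case x_comm i j => rw [sub_right_comm]
  case d_comm i j =>
    rcases eq_or_ne i j with rfl | hij
    · rfl
    · rw [Pi.single_eq_of_ne hij, Pi.single_eq_of_ne hij.symm, add_right_comm s]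
      ring
  case d_x i j =>
    rcases eq_or_ne i j with rfl | hij
    · rw [if_pos rfl, Pi.sub_apply, Pi.single_eq_same, add_sub_cancel_right, sub_add_cancel,
        sub_add_cancel, map_one, Module.End.one_apply]
      ring
    · rw [if_neg hij, Pi.sub_apply, Pi.single_eq_of_ne hij, map_zero, LinearMap.zero_apply,
        Pi.zero_apply, sub_zero, add_zero, add_sub_right_comm]
  case x_xInv i => rw [sub_add_cancel]
  case xInv_x i => rw [add_sub_cancel_right]

variable (n) in
/-- The representation of the Laurent Weyl algebra on functions on `ℂ^n`, in which `f` stands for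
the formal series `∑_s f(s) x^s`. -/
noncomputable def mellin : LaurentWeyl n →ₐ[ℂ] Module.End ℂ ((Fin n → ℂ) → ℂ) :=
  lift mellinGen mellinGen_rel

theorem mellin_gen (g : LaurentWeylGen n) : mellin n (gen g) = mellinGen g :=
  lift_gen _ _ g

theorem mellin_xPow (w : Fin n → ℤ) (f : (Fin n → ℂ) → ℂ) (s : Fin n → ℂ) :
    mellin n (xPow w) f s = f (s - Int.cast ∘ w) := by
  have hcast (v w : Fin n → ℤ) : (Int.cast ∘ (v + w) : Fin n → ℂ) = Int.cast ∘ v + Int.cast ∘ w :=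
    funext fun _ => Int.cast_add _ _
  have hsingle (i : Fin n) (k : ℤ) : (Int.cast ∘ Pi.single i k : Fin n → ℂ) = Pi.single i ↑k :=
    funext fun j =>
      Pi.apply_single (fun _ : Fin n => (Int.cast : ℤ → ℂ)) (fun _ => Int.cast_zero) i k j
  induction w using intVec_induction generalizing f s with
  | zero => simp [xPow_zero]
  | add v w hv hw => rw [xPow_add, map_mul, Module.End.mul_apply, hv, hw, hcast, sub_sub]
  | single i =>
    rw [← gen_x_eq_xPow, mellin_gen, mellinGen_x_apply, hsingle, Int.cast_one]
  | single_neg i =>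
    rw [← gen_xInv_eq_xPow, mellin_gen, mellinGen_xInv_apply, hsingle, Int.cast_neg, Int.cast_one,
      Pi.single_neg, sub_neg_eq_add]

theorem mellin_theta (i : Fin n) (f : (Fin n → ℂ) → ℂ) (s : Fin n → ℂ) :
    mellin n (theta i) f s = s i * f s := by
  change mellin n (gen (.x i) * gen (.d i)) f s = _
  rw [map_mul, mellin_gen, mellin_gen, Module.End.mul_apply, mellinGen_x_apply, mellinGen_d_apply,
    Pi.sub_apply, Pi.single_eq_same, sub_add_cancel, sub_add_cancel]

theorem mellin_thetaPoly (p : MvPolynomial (Fin n) ℂ) (f : (Fin n → ℂ) → ℂ) (s : Fin n → ℂ) :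
    mellin n (thetaPoly n p) f s = eval s p * f s := by
  induction p using MvPolynomial.induction_on generalizing f s with
  | C c =>
    rw [← algebraMap_eq, AlgHom.commutes, AlgHom.commutes, algebraMap_eq, eval_C]
    rfl
  | add p q hp hq => simp only [map_add, LinearMap.add_apply, Pi.add_apply, hp, hq, add_mul]
  | mul_X p i hp =>
    rw [map_mul, map_mul, Module.End.mul_apply, hp, thetaPoly_X, mellin_theta, map_mul, eval_X,
      mul_assoc]

theorem mellin_normalForm (F : (Fin n → ℤ) →₀ MvPolynomial (Fin n) ℂ) (f : (Fin n → ℂ) → ℂ)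
    (s : Fin n → ℂ) :
    mellin n (normalForm n F) f s
      = F.sum fun w p => eval (s - Int.cast ∘ w) p * f (s - Int.cast ∘ w) := by
  simp [normalForm_apply, Finsupp.sum, mellin_xPow, mellin_thetaPoly]

theorem mellin_comp_normalForm_injective :
    Function.Injective ((mellin n).toLinearMap ∘ₗ normalForm n) := by
  classical
  refine (injective_iff_map_eq_zero _).2 fun F hF => Finsupp.ext fun w => MvPolynomial.funext ?_
  intro t
  -- Applied to the indicator function of `t`, the operator has the value `p_w(t)` at `t + w`.
  have ht := congrFun (LinearMap.congr_fun hF (Pi.single t 1)) (t + Int.cast ∘ w)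
  have hne (v : Fin n → ℤ) (hv : v ≠ w) : t + Int.cast ∘ w - Int.cast ∘ v ≠ t := fun h => hv <| by
    rw [add_sub_assoc, add_eq_left, sub_eq_zero] at h
    exact (Int.cast_injective.comp_left h).symm
  rw [LinearMap.comp_apply, AlgHom.toLinearMap_apply, mellin_normalForm, Finsupp.sum_eq_single w
    (fun v _ hv => by rw [Pi.single_eq_of_ne (hne v hv), mul_zero]) (by simp)] at ht
  simpa using ht

theorem normalForm_injective : Function.Injective (normalForm n) :=
  Function.Injective.of_comp (f := (mellin n).toLinearMap) mellin_comp_normalForm_injective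

theorem mellin_injective : Function.Injective (mellin n) :=
  Function.Injective.of_comp_right mellin_comp_normalForm_injective normalForm_surjective

end Mellin

/-! ### Invariant operators -/

section Coefficients

variable {n : ℕ}

/-- The coefficient `p_w` of `x^w` in the normal form `∑_w x^w p_w(θ)` of an operator. -/
noncomputable def coeff (w : Fin n → ℤ) : LaurentWeyl n →ₗ[ℂ] MvPolynomial (Fin n) ℂ :=
  Finsupp.lapply w ∘ₗ
    (LinearEquiv.ofBijective (normalForm n) ⟨normalForm_injective, normalForm_surjective⟩).symm

theorem coeff_normalForm (w : Fin n → ℤ) (F : (Fin n → ℤ) →₀ MvPolynomial (Fin n) ℂ) :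
    coeff w (normalForm n F) = F w :=
  DFunLike.congr_fun (LinearEquiv.ofBijective_symm_apply_apply (normalForm n)
    (h := ⟨normalForm_injective, normalForm_surjective⟩) F) w

theorem scale_thetaPoly (c : Fin n → ℂˣ) (p : MvPolynomial (Fin n) ℂ) :
    scale c (thetaPoly n p) = thetaPoly n p := by
  have h : (scale c).comp (thetaPoly n) = thetaPoly n := MvPolynomial.algHom_ext fun i => by
    rw [AlgHom.comp_apply, thetaPoly_X, scale_theta]
  exact DFunLike.congr_fun h p

theorem coeff_scale (c : Fin n → ℂˣ) (w : Fin n → ℤ) (P : LaurentWeyl n) :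
    coeff w (scale c P) = ((∏ i, c i ^ w i : ℂˣ) : ℂ) • coeff w P := by
  obtain ⟨F, rfl⟩ := normalForm_surjective P
  induction F using Finsupp.induction_linear with
  | zero => simp
  | add F G hF hG => simp only [map_add, smul_add, hF, hG]
  | single v p =>
    rw [normalForm_single, map_mul, scale_xPow, scale_thetaPoly, smul_mul_assoc,
      ← normalForm_single, map_smul, coeff_normalForm]
    rcases eq_or_ne v w with rfl | h
    · rfl
    · rw [Finsupp.single_eq_of_ne h.symm, smul_zero, smul_zero]

end Coefficients

section Invariants

variable {d n m : ℕ} {A : Matrix (Fin d) (Fin n) ℤ} {B : Matrix (Fin n) (Fin m) ℤ}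

theorem prod_character_mulSingle_zpow (A : Matrix (Fin d) (Fin n) ℤ) (w : Fin n → ℤ) (k : Fin d)
    (c : ℂˣ) : ∏ i, character (Pi.mulSingle k c) (A.col i) ^ w i = c ^ A.mulVec w k := by
  have hcol (i : Fin n) : character (Pi.mulSingle k c) (A.col i) = c ^ A k i := by
    rw [character, Fintype.prod_eq_single k fun j hj => by
      rw [Pi.mulSingle_eq_of_ne hj, one_zpow], Pi.mulSingle_eq_same, Matrix.col_apply]
  simp only [hcol, ← zpow_mul]
  exact (map_prod (zpowersHom ℂˣ c) (fun i => Multiplicative.ofAdd (A k i * w i)) _).symm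

theorem mulVec_eq_zero_of_coeff_ne_zero {P : LaurentWeyl n} (hP : P ∈ invariants A)
    {w : Fin n → ℤ} (hw : coeff w P ≠ 0) : A.mulVec w = 0 := by
  funext k
  let two : ℂˣ := Units.mk0 2 two_ne_zero
  have hscale := coeff_scale (fun i => character (Pi.mulSingle k two) (A.col i)) w P
  rw [show scale _ P = P from hP (Pi.mulSingle k two), prod_character_mulSingle_zpow] at hscale
  have hone : ((two ^ A.mulVec w k : ℂˣ) : ℂ) = 1 :=
    smul_left_injective ℂ hw (hscale.symm.trans (one_smul ℂ _).symm)
  have hnorm := congrArg norm hone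
  rw [Units.val_zpow_eq_zpow_val, norm_zpow, norm_one, Units.val_mk0, Complex.norm_ofNat] at hnorm
  exact (zpow_eq_one_iff_right₀ zero_le_two (by norm_num)).1 hnorm

variable (A) in
/-- The algebra homomorphism `p ↦ p(θ_1, …, θ_n)` into the invariants. -/
noncomputable def invThetaPoly : MvPolynomial (Fin n) ℂ →ₐ[ℂ] invariants A :=
  (thetaPoly n).codRestrict (invariants A) fun p _ => scale_thetaPoly _ p

theorem invThetaPoly_affineForm (κ : Fin n → ℂ) (k : Fin d) :
    invThetaPoly A (affineForm (A.map (Int.cast : ℤ → ℂ) k)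
        (-(A.map (Int.cast : ℤ → ℂ)).mulVec κ k))
      = euler A k - algebraMap ℂ (invariants A) ((A.map (Int.cast : ℤ → ℂ)).mulVec κ k) := by
  have hX (j : Fin n) : invThetaPoly A (X j) = ⟨theta j, theta_mem_invariants A j⟩ :=
    Subtype.ext (thetaPoly_X j)
  rw [affineForm, map_add, map_neg, map_neg, ← algebraMap_eq, AlgHom.commutes, euler,
    sub_eq_add_neg]
  simp only [map_sum, Matrix.map_apply, Int.cast_smul_eq_zsmul, map_zsmul, hX]

variable (hB : Submodule.span ℤ (Set.range B.col) = LinearMap.ker A.mulVecLin)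

/-- The invariant operator `∑_v x^{Bv} p_v(θ)` with coefficients `p_v`. -/
noncomputable def invForm : ((Fin m → ℤ) →₀ MvPolynomial (Fin n) ℂ) →ₗ[ℂ] invariants A :=
  Finsupp.lsum ℂ fun v =>
    LinearMap.mulLeft ℂ (⟨xPow (B.mulVec v), xPow_mem_invariants A _ (mulVec_mulVec_eq_zero hB v)⟩ :
      invariants A) ∘ₗ (invThetaPoly A).toLinearMap

theorem invForm_single (v : Fin m → ℤ) (p : MvPolynomial (Fin n) ℂ) :
    invForm hB (Finsupp.single v p)
      = ⟨xPow (B.mulVec v), xPow_mem_invariants A _ (mulVec_mulVec_eq_zero hB v)⟩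
        * invThetaPoly A p := by
  simp [invForm]

theorem coe_invForm_single (v : Fin m → ℤ) (p : MvPolynomial (Fin n) ℂ) :
    (invForm hB (Finsupp.single v p) : LaurentWeyl n) = xPow (B.mulVec v) * thetaPoly n p := by
  rw [invForm_single]
  rfl

theorem invForm_single_zero (p : MvPolynomial (Fin n) ℂ) :
    invForm hB (Finsupp.single 0 p) = invThetaPoly A p := by
  refine Subtype.ext ?_
  rw [coe_invForm_single, Matrix.mulVec_zero, xPow_zero, one_mul]
  rfl

theorem invForm_single_prod_X_pow (v : Fin m → ℤ) (u : Fin n → ℕ) :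
    invForm hB (Finsupp.single v (∏ i, X i ^ u i))
      = invMonomial A (B.mulVec v) (mulVec_mulVec_eq_zero hB v) u := by
  refine Subtype.ext ?_
  rw [coe_invForm_single, thetaPoly_prod_pow]
  simp only [thetaPoly_X]
  rfl

theorem invForm_surjective : Function.Surjective (invForm hB) := by
  intro P
  obtain ⟨F, hF⟩ := normalForm_surjective (P : LaurentWeyl n)
  have hP : (P : LaurentWeyl n)
      ∈ (LinearMap.range (invForm hB)).map (invariants A).val.toLinearMap := by
    rw [← hF, normalForm_apply]
    refine sum_mem fun w hw => ?_
    have hAw : w ∈ LinearMap.ker A.mulVecLin := by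
      refine mulVec_eq_zero_of_coeff_ne_zero P.2 ?_
      rw [← hF, coeff_normalForm]
      exact Finsupp.mem_support_iff.1 hw
    rw [← hB, ← Matrix.range_mulVecLin] at hAw
    obtain ⟨v, rfl⟩ := hAw
    exact ⟨_, ⟨Finsupp.single v (F (B.mulVec v)), rfl⟩, coe_invForm_single hB v _⟩
  obtain ⟨_, ⟨G, rfl⟩, hG⟩ := hP
  exact ⟨G, Subtype.ext hG⟩

theorem span_invMonomial :
    Submodule.span ℂ (Set.range fun p : (Fin m → ℤ) × (Fin n → ℕ) =>
      invMonomial A (B.mulVec p.1) (mulVec_mulVec_eq_zero hB p.1) p.2) = ⊤ := by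
  refine eq_top_iff.2 fun P _ => ?_
  obtain ⟨F, rfl⟩ := invForm_surjective hB P
  induction F using Finsupp.induction_linear with
  | zero => rw [map_zero]; exact zero_mem _
  | add F G hF hG => rw [map_add]; exact add_mem (hF trivial) (hG trivial)
  | single v p =>
    induction p using MvPolynomial.induction_on' with
    | monomial u c =>
      have hmonomial : monomial u c = c • ∏ i, (X i : MvPolynomial (Fin n) ℂ) ^ u i := by
        rw [monomial_eq, Finsupp.prod_fintype _ _ fun _ => pow_zero _, smul_eq_C_mul]
      rw [hmonomial, ← Finsupp.smul_single, map_smul, invForm_single_prod_X_pow]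
      exact Submodule.smul_mem _ _ (Submodule.subset_span ⟨(v, u), rfl⟩)
    | add p q hp hq => rw [Finsupp.single_add, map_add]; exact add_mem (hp trivial) (hq trivial)

end Invariants

/-! ### Restriction to the affine subspace `κ + im B` -/

section Restriction

variable {d n m : ℕ} {A : Matrix (Fin d) (Fin n) ℤ} {B : Matrix (Fin n) (Fin m) ℤ}

/-- The restriction of functions on `ℂ^n` along `s ↦ B s + κ`. -/
def restrict (B : Matrix (Fin n) (Fin m) ℤ) (κ : Fin n → ℂ) :
    ((Fin n → ℂ) → ℂ) →ₗ[ℂ] (Fin m → ℂ) → ℂ :=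
  LinearMap.funLeft ℂ ℂ fun s => (B.map (Int.cast : ℤ → ℂ)).mulVec s + κ

theorem restrict_surjective
    (hBind : LinearIndependent ℤ B.col)
    (hB : Submodule.span ℤ (Set.range B.col) = LinearMap.ker A.mulVecLin) (κ : Fin n → ℂ) :
    Function.Surjective (restrict B κ) := by
  obtain ⟨C, D, -, hDB⟩ := exists_splitting (K := ℂ) hBind hB
  refine LinearMap.funLeft_surjective_of_injective _ _ _ fun s t hst => ?_
  have h := congrArg D.mulVec (add_right_cancel hst)
  rwa [Matrix.mulVec_mulVec, Matrix.mulVec_mulVec, hDB, Matrix.one_mulVec, Matrix.one_mulVec] at h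

variable (B) in
/-- The coefficientwise substitution `p(s) ↦ p(B s + κ)`. -/
noncomputable def substCoeff (κ : Fin n → ℂ) :
    ((Fin m → ℤ) →₀ MvPolynomial (Fin n) ℂ) →ₗ[ℂ] (Fin m → ℤ) →₀ MvPolynomial (Fin m) ℂ :=
  Finsupp.mapRange.linearMap (affineSubst (B.map (Int.cast : ℤ → ℂ)) κ).toLinearMap

theorem substCoeff_single (κ : Fin n → ℂ) (v : Fin m → ℤ) (p : MvPolynomial (Fin n) ℂ) :
    substCoeff B κ (Finsupp.single v p)
      = Finsupp.single v (affineSubst (B.map (Int.cast : ℤ → ℂ)) κ p) :=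
  Finsupp.mapRange_single (hf := map_zero _)

theorem restrict_comp_mellin_xPow_mul_thetaPoly (κ : Fin n → ℂ) (v : Fin m → ℤ)
    (p : MvPolynomial (Fin n) ℂ) :
    restrict B κ ∘ₗ mellin n (xPow (B.mulVec v) * thetaPoly n p)
      = mellin m (xPow v * thetaPoly m (affineSubst (B.map (Int.cast : ℤ → ℂ)) κ p))
        ∘ₗ restrict B κ := by
  refine LinearMap.ext fun f => funext fun s => ?_
  simp only [restrict, LinearMap.comp_apply, LinearMap.funLeft_apply, map_mul,
    Module.End.mul_apply, mellin_xPow, mellin_thetaPoly, eval_affineSubst, intCast_comp_mulVec,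
    Matrix.mulVec_sub, sub_add_eq_add_sub]

theorem restrict_comp_mellin_invForm
    (hB : Submodule.span ℤ (Set.range B.col) = LinearMap.ker A.mulVecLin) (κ : Fin n → ℂ)
    (F : (Fin m → ℤ) →₀ MvPolynomial (Fin n) ℂ) :
    restrict B κ ∘ₗ mellin n (invForm hB F)
      = mellin m (normalForm m (substCoeff B κ F)) ∘ₗ restrict B κ := by
  induction F using Finsupp.induction_linear with
  | zero => simp
  | add F G hF hG =>
    simp only [map_add, Subalgebra.coe_add, LinearMap.comp_add, LinearMap.add_comp, hF, hG]
  | single v p =>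
    rw [coe_invForm_single, restrict_comp_mellin_xPow_mul_thetaPoly, substCoeff_single,
      normalForm_single]

theorem exists_algHom_restrict (hBind : LinearIndependent ℤ B.col)
    (hB : Submodule.span ℤ (Set.range B.col) = LinearMap.ker A.mulVecLin) (κ : Fin n → ℂ) :
    ∃ δ : invariants A →ₐ[ℂ] LaurentWeyl m,
      ∀ P : invariants A, restrict B κ ∘ₗ mellin n P = mellin m (δ P) ∘ₗ restrict B κ := by
  refine exists_algHom_intertwines (ρ := (mellin n).comp (invariants A).val) mellin_injective
    (restrict_surjective hBind hB κ) fun P => ?_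
  obtain ⟨F, rfl⟩ := invForm_surjective hB P
  exact ⟨_, restrict_comp_mellin_invForm hB κ F⟩

variable (hBind : LinearIndependent ℤ B.col)
  (hB : Submodule.span ℤ (Set.range B.col) = LinearMap.ker A.mulVecLin) (κ : Fin n → ℂ)

/-- The homomorphism `δ_{B,κ}`, characterised by `(P f)|_{κ + im B} = δ(P) (f|_{κ + im B})` for all
functions `f`. -/
noncomputable def hornHom : invariants A →ₐ[ℂ] LaurentWeyl m :=
  (exists_algHom_restrict hBind hB κ).choose

theorem hornHom_invForm (F : (Fin m → ℤ) →₀ MvPolynomial (Fin n) ℂ) :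
    hornHom hBind hB κ (invForm hB F) = normalForm m (substCoeff B κ F) :=
  eq_of_intertwines (ρ := (mellin n).comp (invariants A).val) mellin_injective
    (restrict_surjective hBind hB κ) ((exists_algHom_restrict hBind hB κ).choose_spec _)
    (restrict_comp_mellin_invForm hB κ F)

theorem hornHom_invThetaPoly (p : MvPolynomial (Fin n) ℂ) :
    hornHom hBind hB κ (invThetaPoly A p)
      = thetaPoly m (affineSubst (B.map (Int.cast : ℤ → ℂ)) κ p) := by
  rw [← invForm_single_zero hB, hornHom_invForm, substCoeff_single, normalForm_single, xPow_zero,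
    one_mul]

theorem hornHom_invMonomial (v : Fin m → ℤ) (u : Fin n → ℕ) :
    hornHom hBind hB κ (invMonomial A (B.mulVec v) (mulVec_mulVec_eq_zero hB v) u)
      = hornMonomial B κ v u := by
  have hrow (i : Fin n) : thetaPoly m (affineForm (B.map (Int.cast : ℤ → ℂ) i) (κ i))
      = ∑ j, B i j • theta j + algebraMap ℂ (LaurentWeyl m) (κ i) := by
    rw [affineForm, map_add, ← algebraMap_eq, AlgHom.commutes]
    simp only [map_sum, Matrix.map_apply, Int.cast_smul_eq_zsmul, map_zsmul, thetaPoly_X]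
  rw [← invForm_single_prod_X_pow hB, hornHom_invForm, substCoeff_single, normalForm_single]
  simp only [map_prod, map_pow, affineSubst_X]
  simp only [thetaPoly_prod_pow, hrow]
  rfl

theorem hornHom_surjective : Function.Surjective (hornHom hBind hB κ) := fun Q => by
  obtain ⟨C, D, -, hDB⟩ := exists_splitting (K := ℂ) hBind hB
  obtain ⟨G, rfl⟩ := normalForm_surjective Q
  obtain ⟨F, rfl⟩ : ∃ F, substCoeff B κ F = G :=
    Finsupp.mapRange_surjective _ (map_zero _)
      (fun q => ⟨_, affineSubst_affineSubst_of_mul_eq_one hDB κ q⟩) G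
  exact ⟨_, hornHom_invForm hBind hB κ F⟩

theorem invForm_mem_of_forall_invThetaPoly_mem {J : TwoSidedIdeal (invariants A)}
    {F : (Fin m → ℤ) →₀ MvPolynomial (Fin n) ℂ} (h : ∀ v, invThetaPoly A (F v) ∈ J) :
    invForm hB F ∈ J := by
  change invForm hB F ∈ J.asIdeal
  rw [invForm, Finsupp.lsum_apply]
  exact sum_mem fun v _ => J.mul_mem_left _ _ (h v)

theorem ker_hornHom :
    TwoSidedIdeal.ker (hornHom hBind hB κ) = TwoSidedIdeal.span (Set.range fun k =>
      euler A k - algebraMap ℂ (invariants A) ((A.map (Int.cast : ℤ → ℂ)).mulVec κ k)) := by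
  obtain ⟨C, D, hCD, -⟩ := exists_splitting (K := ℂ) hBind hB
  have hker := ker_affineSubst (map_intCast_mul_eq_zero hB) hCD κ
  set J := TwoSidedIdeal.span (Set.range fun k =>
    euler A k - algebraMap ℂ (invariants A) ((A.map (Int.cast : ℤ → ℂ)).mulVec κ k))
  refine le_antisymm (fun P hP => ?_) (TwoSidedIdeal.span_le.2 ?_)
  · obtain ⟨F, rfl⟩ := invForm_surjective hB P
    rw [TwoSidedIdeal.mem_ker, hornHom_invForm] at hP
    have hF : substCoeff B κ F = 0 := (map_eq_zero_iff _ normalForm_injective).1 hP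
    have hle : RingHom.ker (affineSubst (B.map (Int.cast : ℤ → ℂ)) κ)
        ≤ J.asIdeal.comap (invThetaPoly A) := by
      rw [hker, Ideal.span_le]
      rintro _ ⟨k, rfl⟩
      change invThetaPoly A _ ∈ J
      rw [invThetaPoly_affineForm]
      exact TwoSidedIdeal.subset_span ⟨k, rfl⟩
    exact invForm_mem_of_forall_invThetaPoly_mem hB fun v => hle (DFunLike.congr_fun hF v)
  · rintro _ ⟨k, rfl⟩
    have hk : affineForm _ _ ∈ RingHom.ker _ := hker.ge (Ideal.subset_span ⟨k, rfl⟩)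
    refine (TwoSidedIdeal.mem_ker _).2 ?_
    beta_reduce
    rw [← invThetaPoly_affineForm, hornHom_invThetaPoly, RingHom.mem_ker.1 hk, map_zero]

end Restriction

theorem proposition5_general {n m d : ℕ} {A : Matrix (Fin d) (Fin n) ℤ}
    {B : Matrix (Fin n) (Fin m) ℤ} (hBind : LinearIndependent ℤ B.col)
    (hB : Submodule.span ℤ (Set.range B.col) = LinearMap.ker A.mulVecLin)
    {β : Fin d → ℂ} {κ : Fin n → ℂ} (hκ : (A.map (Int.cast : ℤ → ℂ)).mulVec κ = β) :
    Submodule.span ℂ (Set.range fun p : (Fin m → ℤ) × (Fin n → ℕ) =>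
        invMonomial A (B.mulVec p.1) (mulVec_mulVec_eq_zero hB p.1) p.2) = ⊤ ∧
      ∃ δ : invariants A →ₐ[ℂ] LaurentWeyl m,
        (∀ (v : Fin m → ℤ) (u : Fin n → ℕ),
          δ (invMonomial A (B.mulVec v) (mulVec_mulVec_eq_zero hB v) u) = hornMonomial B κ v u) ∧
        Function.Surjective δ ∧
        TwoSidedIdeal.ker δ =
          TwoSidedIdeal.span (Set.range fun k : Fin d =>
            euler A k - algebraMap ℂ (invariants A) (β k)) := by
  subst hκ
  exact ⟨span_invMonomial hB, hornHom hBind hB κ, hornHom_invMonomial hBind hB κ,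
    hornHom_surjective hBind hB κ, ker_hornHom hBind hB κ⟩

end LaurentWeyl

open LaurentWeyl in
theorem proposition5 (n m d : ℕ) (hm : 0 < m) (hmn : m < n) (hd : d = n - m)
    (A : Matrix (Fin d) (Fin n) ℤ)
    (hAspan : Submodule.span ℤ (Set.range A.col) = ⊤)
    (hApointed : ∃ h : Fin d → ℝ, ∀ i : Fin n, 0 < ∑ k, h k * (A k i : ℝ))
    (B : Matrix (Fin n) (Fin m) ℤ)
    (hB : Submodule.span ℤ (Set.range B.col) = LinearMap.ker A.mulVecLin)
    (β : Fin d → ℂ) (κ : Fin n → ℂ)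
    (hκ : (A.map (Int.cast : ℤ → ℂ)).mulVec κ = β) :
    Submodule.span ℂ (Set.range fun p : (Fin m → ℤ) × (Fin n → ℕ) =>
        invMonomial A (B.mulVec p.1) (mulVec_mulVec_eq_zero hB p.1) p.2) = ⊤ ∧
      ∃ δ : invariants A →ₐ[ℂ] LaurentWeyl m,
        (∀ (v : Fin m → ℤ) (u : Fin n → ℕ),
          δ (invMonomial A (B.mulVec v) (mulVec_mulVec_eq_zero hB v) u) = hornMonomial B κ v u) ∧
        Function.Surjective δ ∧
        TwoSidedIdeal.ker δ =
          TwoSidedIdeal.span (Set.range fun k : Fin d =>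
            euler A k - algebraMap ℂ (invariants A) (β k)) := by
  have hBind : LinearIndependent ℤ B.col :=
    linearIndependent_col_of_span_col_eq_ker (by simp only [Fintype.card_fin]; omega) hAspan hB
  exact proposition5_general hBind hB hκ
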